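/- Let $R$ be a commutative semiring with $0\neq 1$ that is zero-sum-free ($a+b=0$ implies $a=b=0$), let $A$ be a finite abelian group with nerve $NA$ (so $(NA)_n=A^n$), and let $G$ be a group. For a set $U$, let $D_R(U)$ be the set of finitely supported functions $U\to R$ with total sum $1$; applied levelwise this defines $D_R$ on simplicial sets, with unit $\delta_Y:Y\to D_R(Y)$ sending a simplex to the delta-distribution at it. Let $M$ be a partial group, that is, a simplicial set with exactly one vertex and injective spine maps $M_n\to M_1^n$ $(n\ge 1)$, admitting a simplicial map $\nu:M\to M^{\mathrm{op}}$ such that for every $x\in M_n$, $n\geq 1$, there is a simplex $(\nu(x),x)\in M_{2n}$ with product $1$. Let $\beta:M_2\to A$ be a normalized $2$-cocycle and let $$NA\xrightarrow{\ i\ }E=NA\times_\beta M\xrightarrow{\ \pi\ }M$$ be the associated central extension: $E$ is the twisted product with $E_n=A^n\times M_n$, in which products of $1$-simplices are given by $(a_1,x_1)\cdot(a_2,x_2)=(a_1+a_2+\beta(x_1,x_2),\,x_1\cdot x_2)$. Suppose $G$ acts on $E$ by simplicial automorphisms that fix $i(NA)$ pointwise and commute with the translation action of $NA$ on $E$; then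 $G$ acts on $M=E/NA$, and trivially on $NA$. Write $X/\!/G=EG\times_G X$ for the Borel construction, and let $\eta_G:M/\!/G\to E/\!/G$ be the pseudo-section $[(1,g_1,\dots,g_n),x]\mapsto[(1,g_1,\dots,g_n),(0,x)]$. Let $\beta_G:(M/\!/G)_2\to A$ be the $2$-cocycle determined by $\eta_G(x)\cdot\eta_G(y)=\beta_G(x,y)\cdot\eta_G(x\cdot y)$ for $(x,y)\in(M/\!/G)_2$, and let $[\beta_G]\in H^2(M/\!/G,A)$ be its class. If $[\beta_G]\neq 0$, then every $G$-equivariant simplicial distribution $p:E\to D_R(NA)$ relative to $NA$ (a $G$-equivariant simplicial map with $p\circ i=\delta_{NA}$) is $G$-equivariantly contextual: there is no $d\in D_R(\mathrm{dDist}_G(E,NA))$ with $p=\sum_{q} d(q)\,q$, where $\mathrm{dDist}_G(E,NA)$ is the set of distributions of the form $\delta_{NA}\circ s$ with $s:E\to NA$ a $G$-equivariant simplicial map. -/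

import Mathlib

open CategoryTheory Simplicial Opposite

universe u v

namespace EquivariantContextuality

/-! ### The distribution monad on sets and on simplicial sets -/

/-- The set `D_R(U)` of finitely supported functions `U → R` with total mass `1`. -/
def Dist (R : Type u) [CommSemiring R] (U : Type v) : Type (max u v) :=
  {p : U →₀ R // (p.sum fun _ r => r) = 1}

namespace Dist

variable {R : Type u} [CommSemiring R]

/-- The push-forward `D_R(f)`. -/
noncomputable def map {U V : Type*} (f : U → V) (p : Dist R U) : Dist R V :=
  ⟨Finsupp.mapDomain f p.1, by
    rw [Finsupp.sum_mapDomain_index (fun _ => rfl) (fun _ _ _ => rfl)]; exact p.2⟩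

/-- The delta-distribution with peak at `u`. -/
noncomputable def delta (R : Type u) [CommSemiring R] {U : Type*} (u : U) : Dist R U :=
  ⟨Finsupp.single u 1, by simp⟩

/-- The mixture `∑ t, d(t) • f(t)` of a family of distributions. -/
noncomputable def mix {T U : Type*} (d : Dist R T) (f : T → Dist R U) : Dist R U :=
  ⟨d.1.sum fun t r => r • (f t).1, by
    have key : ∀ q : U →₀ R,
        (q.sum fun _ r => r) = Finsupp.linearCombination R (fun _ => (1 : R)) q := by
      intro q; simp [Finsupp.linearCombination_apply]
    have h2 : ∀ t, Finsupp.linearCombination R (fun _ : U => (1 : R)) (f t).1 = 1 := fun t => by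
      rw [← key]; exact (f t).2
    rw [key, map_finsuppSum]
    simp only [map_smul, h2, smul_eq_mul, mul_one]
    exact d.2⟩

theorem map_mix {T U V : Type*} (d : Dist R T) (f : T → Dist R U) (g : U → V) :
    (d.mix f).map g = d.mix fun t => (f t).map g := by
  apply Subtype.ext
  change Finsupp.lmapDomain R R g (d.1.sum fun t r => r • (f t).1) = _
  rw [map_finsuppSum]
  simp only [map_smul]
  rfl

end Dist

/-- The functor `D_R` on sets. -/
noncomputable def distFunctor (R : Type u) [CommSemiring R] : Type u ⥤ Type u where
  obj U := Dist R U
  map f := ↾(Dist.map f)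
  map_id U := by
    ext p
    exact Subtype.ext Finsupp.mapDomain_id
  map_comp f g := by
    ext p
    exact Subtype.ext (Finsupp.mapDomain_comp (f := f) (g := g) (v := p.1))

/-- The functor `D_R` on simplicial sets, by composition with `D_R` on sets. -/
noncomputable abbrev distSSet (R : Type u) [CommSemiring R] : SSet.{u} ⥤ SSet.{u} :=
  (SimplicialObject.whiskering _ _).obj (distFunctor R)

section Equivariant

variable (R : Type u) [CommSemiring R] {G : Type u} [Group G]

/-- The simplicial `G`-set `D_R(Y)`: the element `g` acts by push-forward along `g`, that is,
`(g • p)(y) = p(g⁻¹ • y)`. -/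
noncomputable abbrev distAction (Y : Action SSet.{u} G) : Action SSet.{u} G :=
  ((distSSet R).mapAction G).obj Y

/-- The unit `δ_Y : Y → D_R(Y)`, as a map of simplicial `G`-sets. -/
noncomputable def deltaHom (Y : Action SSet.{u} G) : Y ⟶ distAction R Y where
  hom :=
    { app := fun _ => ↾(Dist.delta R)
      naturality := by
        intro Δ Δ' f
        ext y
        exact Subtype.ext Finsupp.mapDomain_single.symm }
  comm g := by
    ext Δ y
    exact Subtype.ext Finsupp.mapDomain_single.symm

/-- `G`-equivariant simplicial distributions on `(X, Y)`. -/
abbrev SDist (X Y : Action SSet.{u} G) : Type u := X ⟶ distAction R Y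

/-- `G`-equivariant deterministic distributions on `(X, Y)`: those of the form `δ_Y ∘ s`. -/
def DDist (X Y : Action SSet.{u} G) : Type u :=
  {q : SDist R X Y // ∃ s : X ⟶ Y, q = s ≫ deltaHom R Y}

variable {R}

/-- The value `p_σ` of a simplicial distribution at a simplex. -/
def SDist.at {X Y : Action SSet.{u} G} (p : SDist R X Y) {Δ : SimplexCategoryᵒᵖ}
    (σ : X.V.obj Δ) : Dist R (Y.V.obj Δ) :=
  p.hom.app Δ σ

theorem SDist.at_map {X Y : Action SSet.{u} G} (p : SDist R X Y) {Δ Δ' : SimplexCategoryᵒᵖ}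
    (f : Δ ⟶ Δ') (σ : X.V.obj Δ) :
    p.at (X.V.map f σ) = (p.at σ).map (Y.V.map f) :=
  NatTrans.naturality_apply p.hom f σ

theorem SDist.at_act {X Y : Action SSet.{u} G} (p : SDist R X Y) {Δ : SimplexCategoryᵒᵖ}
    (g : G) (σ : X.V.obj Δ) :
    p.at ((X.ρ g).app Δ σ) = (p.at σ).map ((Y.ρ g).app Δ) :=
  ConcreteCategory.congr_hom (congrArg (fun h => NatTrans.app h Δ) (p.comm g)) σ

/-- The comparison map `Θ_G`, sending `∑ d(r) δ^r` to the simplicial distribution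
`σ ↦ ∑ d(r) δ^r_σ`, i.e. `Θ_G(d)_σ(θ) = ∑_{r : r_σ = θ} d(r)`. -/
noncomputable def comparison {X Y : Action SSet.{u} G} (d : Dist R (DDist R X Y)) :
    SDist R X Y where
  hom :=
    { app := fun Δ => ↾fun σ => d.mix fun q => q.1.at σ
      naturality := by
        intro Δ Δ' f
        ext σ
        change d.mix _ = Dist.map _ (d.mix _)
        rw [Dist.map_mix]
        exact congrArg d.mix (funext fun q => q.1.at_map f σ) }
  comm g := by
    ext Δ σ
    change d.mix _ = Dist.map _ (d.mix _)
    rw [Dist.map_mix]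
    exact congrArg d.mix (funext fun q => q.1.at_act g σ)

/-- `p` is `G`-equivariantly contextual if it is not in the image of `Θ_G`. -/
def IsEquivariantlyContextual {X Y : Action SSet.{u} G} (p : SDist R X Y) : Prop :=
  p ∉ Set.range (comparison (R := R) (X := X) (Y := Y))

/-- `p : X → D_R(Y)` is relative to `i : Y → X` if `p ∘ i = δ_Y`. -/
def IsRelative {X Y : Action SSet.{u} G} (i : Y ⟶ X) (p : SDist R X Y) : Prop :=
  i ≫ p = deltaHom R Y

end Equivariant

/-! ### Partial groups -/

/-- A reduced simplicial set with injective spine maps. -/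
class IsPartialMonoid (M : SSet.{u}) : Prop where
  reduced : ∃ x : M _⦋0⦌, ∀ y, y = x
  spine_injective : ∀ n : ℕ, 1 ≤ n →
    Function.Injective fun (x : M _⦋n⦌) (i : Fin n) => M.map (SimplexCategory.mkOfSucc i).op x

/-- The unique vertex. -/
noncomputable def vertex (M : SSet.{u}) [IsPartialMonoid M] : M _⦋0⦌ :=
  (IsPartialMonoid.reduced (M := M)).choose

/-- A partial monoid with an inversion `ν : M → Mᵒᵖ`: for every `x ∈ M_n`, `n ≥ 1`, there is a
simplex `w = (ν(x), x) ∈ M_{2n}` (given by its spine) whose product `Π_{2n}(w)` is `1`. -/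
class IsPartialGroup (M : SSet.{u}) : Prop extends IsPartialMonoid M where
  exists_inversion : ∃ ν : M ⟶ M.op, ∀ n : ℕ, 1 ≤ n → ∀ x : M _⦋n⦌, ∃ w : M _⦋n + n⦌,
    (∀ i : Fin n, M.map (SimplexCategory.mkOfSucc (Fin.castAdd n i)).op w =
      M.map (SimplexCategory.mkOfSucc i).op (SSet.opObjEquiv (ν.app _ x))) ∧
    (∀ i : Fin n, M.map (SimplexCategory.mkOfSucc (Fin.natAdd n i)).op w =
      M.map (SimplexCategory.mkOfSucc i).op x) ∧
    M.map (SimplexCategory.diag (n + n)).op w = M.σ 0 (vertex M)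

/-- In a simplicial set, `x · y = z` for `1`-simplices: some `2`-simplex `w` has `d₂ w = x`,
`d₀ w = y` and `d₁ w = z`. In a partial monoid `w` is determined by `x` and `y`. -/
def IsProduct (X : SSet.{u}) (x y z : X _⦋1⦌) : Prop :=
  ∃ w : X _⦋2⦌, X.δ 2 w = x ∧ X.δ 0 w = y ∧ X.δ 1 w = z

/-! ### Cohomology of simplicial sets -/

section Cohomology

variable (X : SSet.{u}) (A : Type u) [AddCommGroup A]

/-- The coboundary `d : C^n(X, A) → C^{n+1}(X, A)`, `(d f)(x) = ∑ (-1)^i f(d_i x)`. -/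
def coboundary (n : ℕ) : (X _⦋n⦌ → A) →+ (X _⦋n + 1⦌ → A) where
  toFun f x := ∑ i : Fin (n + 2), (-1 : ℤ) ^ (i : ℕ) • f (X.δ i x)
  map_zero' := by ext; simp
  map_add' f g := by ext; simp [Finset.sum_add_distrib]

/-- `H^2(X, A)`: `2`-cocycles modulo coboundaries of `1`-cochains. -/
abbrev H2 : Type u :=
  (coboundary X A 2).ker ⧸ (coboundary X A 1).range.addSubgroupOf (coboundary X A 2).ker

end Cohomology

/-! ### The nerve of an abelian group and twisted products -/

section Twisted

variable (A : Type u) [AddCommGroup A]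

/-- The restriction of `(a_1, …, a_n)` along `θ : [m] → [n]`: its `i`-th entry is the sum of the
`a_j` with `θ(i-1) < j ≤ θ(i)`. -/
def nerveMap {m n : ℕ} (θ : Fin (m + 1) →o Fin (n + 1)) (a : Fin n → A) : Fin m → A :=
  fun i => Fin.partialSum a (θ i.succ) - Fin.partialSum a (θ i.castSucc)

variable {A}

theorem partialSum_nerveMap {m n : ℕ} (θ : Fin (m + 1) →o Fin (n + 1)) (a : Fin n → A)
    (k : Fin (m + 1)) :
    Fin.partialSum (nerveMap A θ a) k = Fin.partialSum a (θ k) - Fin.partialSum a (θ 0) := by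
  induction k using Fin.induction with
  | zero => simp
  | succ i ih => rw [Fin.partialSum_succ, ih, nerveMap]; abel

theorem nerveMap_add {m n : ℕ} (θ : Fin (m + 1) →o Fin (n + 1)) (a b : Fin n → A) :
    nerveMap A θ (a + b) = nerveMap A θ a + nerveMap A θ b := by
  have h : ∀ k, Fin.partialSum (a + b) k = Fin.partialSum a k + Fin.partialSum b k := by
    intro k
    induction k using Fin.induction with
    | zero => simp
    | succ i ih => simp only [Fin.partialSum_succ, ih, Pi.add_apply]; abel
  ext i
  simp only [nerveMap, h, Pi.add_apply]; abel

theorem nerveMap_id {n : ℕ} (a : Fin n → A) : nerveMap A OrderHom.id a = a := by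
  ext i
  simp [nerveMap, Fin.partialSum_succ]

theorem nerveMap_comp {l m n : ℕ} (ψ : Fin (l + 1) →o Fin (m + 1))
    (θ : Fin (m + 1) →o Fin (n + 1))
    (a : Fin n → A) : nerveMap A ψ (nerveMap A θ a) = nerveMap A (θ.comp ψ) a := by
  ext i
  simp only [nerveMap, partialSum_nerveMap, OrderHom.comp_coe, Function.comp_apply]
  abel

variable (A) in
/-- The nerve space `NA`, with `n`-simplices `A^n`. -/
def nerveSSet : SSet.{u} where
  obj Δ := Fin Δ.unop.len → A
  map f := ↾(nerveMap A f.unop.toOrderHom)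
  map_id Δ := by
    apply ConcreteCategory.hom_ext
    intro e
    exact nerveMap_id e
  map_comp f g := by
    apply ConcreteCategory.hom_ext
    intro e
    exact (nerveMap_comp _ _ e).symm


/-- A normalized `2`-cocycle `β : M_2 → A`; writing `w = (x, y, z) ∈ M_3`, the cocycle condition is
`β(y, z) + β(x, yz) = β(x, y) + β(xy, z)`. -/
structure NormalizedCocycle (M : SSet.{u}) (A : Type u) [AddCommGroup A] where
  toFun : M _⦋2⦌ → A
  cocycle : ∀ w : M _⦋3⦌,
    toFun (M.δ 0 w) + toFun (M.δ 2 w) = toFun (M.δ 3 w) + toFun (M.δ 1 w)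
  normalized_left : ∀ x : M _⦋1⦌, toFun (M.σ 0 x) = 0
  normalized_right : ∀ x : M _⦋1⦌, toFun (M.σ 1 x) = 0

/-- The `2`-face of `x` on the vertices `i ≤ j ≤ k`. -/
def face₂ {M : SSet.{u}} {Δ : SimplexCategoryᵒᵖ} (x : M.obj Δ) (i j k : Fin (Δ.unop.len + 1))
    (h₁ : i ≤ j) (h₂ : j ≤ k) : M _⦋2⦌ :=
  M.map (SimplexCategory.mkOfLeComp i j k h₁ h₂).op x

theorem face₂_map {M : SSet.{u}} {Δ Δ' : SimplexCategoryᵒᵖ} (f : Δ ⟶ Δ') (x : M.obj Δ)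
    (i j k : Fin (Δ'.unop.len + 1)) (h₁ : i ≤ j) (h₂ : j ≤ k) :
    face₂ (M.map f x) i j k h₁ h₂ = face₂ x (f.unop.toOrderHom i) (f.unop.toOrderHom j)
      (f.unop.toOrderHom k) (f.unop.toOrderHom.monotone h₁) (f.unop.toOrderHom.monotone h₂) := by
  unfold face₂
  rw [← comp_apply, ← M.map_comp]
  congr 3
  apply Quiver.Hom.unop_inj
  ext t : 3
  fin_cases t <;> rfl

variable {M : SSet.{u}} (β : NormalizedCocycle M A)

namespace NormalizedCocycle

theorem face₂_left {Δ : SimplexCategoryᵒᵖ} (x : M.obj Δ) (i k : Fin (Δ.unop.len + 1))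
    (h₁ : i ≤ i) (h₂ : i ≤ k) : β.toFun (face₂ x i i k h₁ h₂) = 0 := by
  rw [← β.normalized_left (M.map (SimplexCategory.mkOfLe i k h₂).op x)]
  unfold face₂ SimplicialObject.σ
  rw [← comp_apply, ← M.map_comp]
  congr 4
  apply Quiver.Hom.unop_inj
  ext t : 3
  fin_cases t <;> rfl

theorem face₂_right {Δ : SimplexCategoryᵒᵖ} (x : M.obj Δ) (i k : Fin (Δ.unop.len + 1))
    (h₁ : i ≤ k) (h₂ : k ≤ k) : β.toFun (face₂ x i k k h₁ h₂) = 0 := by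
  rw [← β.normalized_right (M.map (SimplexCategory.mkOfLe i k h₁).op x)]
  unfold face₂ SimplicialObject.σ
  rw [← comp_apply, ← M.map_comp]
  congr 4
  apply Quiver.Hom.unop_inj
  ext t : 3
  fin_cases t <;> rfl

theorem face₂_cocycle {Δ : SimplexCategoryᵒᵖ} (x : M.obj Δ) (i j k l : Fin (Δ.unop.len + 1))
    (h₁ : i ≤ j) (h₂ : j ≤ k) (h₃ : k ≤ l) :
    β.toFun (face₂ x j k l h₂ h₃) + β.toFun (face₂ x i j l h₁ (h₂.trans h₃)) =
      β.toFun (face₂ x i j k h₁ h₂) + β.toFun (face₂ x i k l (h₁.trans h₂) h₃) := by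
  let θ : Fin 4 →o Fin (Δ.unop.len + 1) :=
    { toFun := ![i, j, k, l]
      monotone' := by
        rw [Fin.monotone_iff_le_succ]
        intro t
        fin_cases t
        exacts [h₁, h₂, h₃] }
  have h := β.cocycle (M.map (Quiver.Hom.op (SimplexCategory.Hom.mk θ : ⦋3⦌ ⟶ Δ.unop)) x)
  unfold SimplicialObject.δ at h
  simp only [← comp_apply, ← M.map_comp] at h
  convert h using 4 <;>
  · apply congrArg (fun f => M.map f x)
    apply Quiver.Hom.unop_inj
    ext t : 3
    fin_cases t <;> rfl

/-- The restriction of `(a, x) ∈ A^n × M_n` along an ordinal map `θ`, in the twisted product. -/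
def twistedMap {Δ Δ' : SimplexCategoryᵒᵖ} (f : Δ ⟶ Δ')
    (e : (Fin Δ.unop.len → A) × M.obj Δ) : (Fin Δ'.unop.len → A) × M.obj Δ' :=
  (fun i => nerveMap A f.unop.toOrderHom e.1 i
      + β.toFun (face₂ e.2 0 (f.unop.toOrderHom 0) (f.unop.toOrderHom i.castSucc)
          (Fin.zero_le _) (f.unop.toOrderHom.monotone (Fin.zero_le _)))
      - β.toFun (face₂ e.2 0 (f.unop.toOrderHom 0) (f.unop.toOrderHom i.succ)
          (Fin.zero_le _) (f.unop.toOrderHom.monotone (Fin.zero_le _))),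
    M.map f e.2)

theorem partialSum_twistedMap {Δ Δ' : SimplexCategoryᵒᵖ} (f : Δ ⟶ Δ')
    (e : (Fin Δ.unop.len → A) × M.obj Δ) (k : Fin (Δ'.unop.len + 1)) :
    Fin.partialSum (β.twistedMap f e).1 k =
      Fin.partialSum e.1 (f.unop.toOrderHom k) - Fin.partialSum e.1 (f.unop.toOrderHom 0)
      - β.toFun (face₂ e.2 0 (f.unop.toOrderHom 0) (f.unop.toOrderHom k)
          (Fin.zero_le _) (f.unop.toOrderHom.monotone (Fin.zero_le _))) := by
  induction k using Fin.induction with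
  | zero => simp [face₂_right]
  | succ i ih =>
    rw [Fin.partialSum_succ, ih]
    simp only [twistedMap, nerveMap]
    abel

theorem twistedMap_id (Δ : SimplexCategoryᵒᵖ) (e : (Fin Δ.unop.len → A) × M.obj Δ) :
    β.twistedMap (𝟙 Δ) e = e := by
  refine Prod.ext (funext fun i => ?_) (by simp [twistedMap])
  have h1 := β.face₂_left e.2 0 i.castSucc le_rfl (Fin.zero_le _)
  have h2 := β.face₂_left e.2 0 i.succ le_rfl (Fin.zero_le _)
  have h3 := congrFun (nerveMap_id e.1) i
  have h4 : (β.twistedMap (𝟙 Δ) e).1 i = nerveMap A OrderHom.id e.1 i +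
    β.toFun (face₂ e.2 0 0 i.castSucc le_rfl (Fin.zero_le _)) -
    β.toFun (face₂ e.2 0 0 i.succ le_rfl (Fin.zero_le _)) := rfl
  rw [h4, h1, h2, h3]; simp

theorem twistedMap_comp {Δ Δ' Δ'' : SimplexCategoryᵒᵖ} (f : Δ ⟶ Δ') (g : Δ' ⟶ Δ'')
    (e : (Fin Δ.unop.len → A) × M.obj Δ) :
    β.twistedMap (f ≫ g) e = β.twistedMap g (β.twistedMap f e) := by
  refine Prod.ext (funext fun i => ?_) (by simp [twistedMap])
  have key : ∀ k : Fin (Δ''.unop.len + 1), _ := fun k =>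
    β.face₂_cocycle e.2 0 (f.unop.toOrderHom 0) (f.unop.toOrderHom (g.unop.toOrderHom 0))
      (f.unop.toOrderHom (g.unop.toOrderHom k)) (Fin.zero_le _)
      (f.unop.toOrderHom.monotone (Fin.zero_le _))
      (f.unop.toOrderHom.monotone (g.unop.toOrderHom.monotone (Fin.zero_le _)))
  have k1 := key i.succ
  have k2 := key i.castSucc
  have hL : (β.twistedMap (f ≫ g) e).1 i =
      Fin.partialSum e.1 (f.unop.toOrderHom (g.unop.toOrderHom i.succ))
      - Fin.partialSum e.1 (f.unop.toOrderHom (g.unop.toOrderHom i.castSucc))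
      + β.toFun (face₂ e.2 0 (f.unop.toOrderHom (g.unop.toOrderHom 0))
          (f.unop.toOrderHom (g.unop.toOrderHom i.castSucc)) (Fin.zero_le _)
          (f.unop.toOrderHom.monotone (g.unop.toOrderHom.monotone (Fin.zero_le _))))
      - β.toFun (face₂ e.2 0 (f.unop.toOrderHom (g.unop.toOrderHom 0))
          (f.unop.toOrderHom (g.unop.toOrderHom i.succ)) (Fin.zero_le _)
          (f.unop.toOrderHom.monotone (g.unop.toOrderHom.monotone (Fin.zero_le _)))) := rfl
  have hR : (β.twistedMap g (β.twistedMap f e)).1 i =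
      Fin.partialSum (β.twistedMap f e).1 (g.unop.toOrderHom i.succ)
      - Fin.partialSum (β.twistedMap f e).1 (g.unop.toOrderHom i.castSucc)
      + β.toFun (face₂ (M.map f e.2) 0 (g.unop.toOrderHom 0)
          (g.unop.toOrderHom i.castSucc) (Fin.zero_le _)
          (g.unop.toOrderHom.monotone (Fin.zero_le _)))
      - β.toFun (face₂ (M.map f e.2) 0 (g.unop.toOrderHom 0)
          (g.unop.toOrderHom i.succ) (Fin.zero_le _)
          (g.unop.toOrderHom.monotone (Fin.zero_le _))) := rfl
  rw [hL, hR, partialSum_twistedMap, partialSum_twistedMap, face₂_map, face₂_map]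
  rw [← eq_sub_iff_add_eq] at k1 k2
  rw [k1, k2]
  abel

/-- The twisted product `NA ×_β M`: its `n`-simplices are the pairs `(a, x) ∈ A^n × M_n`, and all
structure maps are those of `NA × M` except for the `0`-th face (and the ordinal maps `θ` with
`θ(0) ≠ 0`), which is twisted so that `(a₁, x₁) · (a₂, x₂) = (a₁ + a₂ + β(x₁, x₂), x₁ · x₂)`. -/
def twistedProduct : SSet.{u} where
  obj Δ := (Fin Δ.unop.len → A) × M.obj Δ
  map f := ↾(β.twistedMap f)
  map_id Δ := by
    apply ConcreteCategory.hom_ext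
    intro e
    exact β.twistedMap_id Δ e
  map_comp f g := by
    apply ConcreteCategory.hom_ext
    intro e
    exact β.twistedMap_comp f g e

/-- The simplex `(a, x)` of the twisted product. -/
def pair {Δ : SimplexCategoryᵒᵖ} (a : Fin Δ.unop.len → A) (x : M.obj Δ) :
    β.twistedProduct.obj Δ := (a, x)

/-- `NA` acts on the twisted product by translation in the first coordinate. -/
def translate {Δ : SimplexCategoryᵒᵖ} (a : Fin Δ.unop.len → A) (e : β.twistedProduct.obj Δ) :
    β.twistedProduct.obj Δ := (a + e.1, e.2)

/-- The projection `π : NA ×_β M → M`. -/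
def proj : β.twistedProduct ⟶ M where
  app _ := ↾fun e => e.2
  naturality _ _ _ := rfl

/-- The inclusion of the fibre, `i : NA → NA ×_β M`, `a ↦ (a, 1)`. -/
noncomputable def incl [IsPartialMonoid M] : nerveSSet A ⟶ β.twistedProduct where
  app Δ := ↾fun a => β.pair a ((SSet.const (X := nerveSSet A) (vertex M)).app Δ a)
  naturality Δ Δ' f := by
    apply ConcreteCategory.hom_ext
    intro a
    refine Prod.ext (funext fun i => ?_)
      (NatTrans.naturality_apply (SSet.const (X := nerveSSet A) (vertex M)) f a)
    have h : ∀ (j k l : Fin (Δ.unop.len + 1)) (h₁ : j ≤ k) (h₂ : k ≤ l),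
        β.toFun (face₂ ((SSet.const (X := nerveSSet A) (vertex M)).app Δ a) j k l h₁ h₂) = 0 := by
      intro j k l h₁ h₂
      have h := β.face₂_left (Δ := op ⦋0⦌) (vertex M) 0 0 le_rfl le_rfl
      rw [← h]
      dsimp [SSet.const, face₂]
      rw [← comp_apply, ← M.map_comp]
      congr 4
      apply Quiver.Hom.unop_inj
      ext t : 3
      fin_cases t <;> rfl
    refine Eq.symm ((congrArg₂ (fun s t => nerveMap A f.unop.toOrderHom a i + s - t)
      (h _ _ _ _ _) (h _ _ _ _ _)).trans ?_)
    rw [add_zero, sub_zero]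
    rfl


/-- The pseudo-section `η(x) = (0, x)`. -/
def eta {Δ : SimplexCategoryᵒᵖ} (x : M.obj Δ) : β.twistedProduct.obj Δ := β.pair 0 x

theorem translate_eta {Δ : SimplexCategoryᵒᵖ} (e : β.twistedProduct.obj Δ) :
    β.translate e.1 (β.eta e.2) = e :=
  Prod.ext (add_zero e.1) rfl

theorem δ_two_pair (a : Fin 2 → A) (x : M _⦋2⦌) :
    β.twistedProduct.δ 2 (β.pair (Δ := op ⦋2⦌) a x) =
      β.pair (Δ := op ⦋1⦌) (fun _ => a 0) (M.δ 2 x) := by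
  refine Prod.ext (funext fun i => ?_) rfl
  fin_cases i
  refine (congrArg₂ (fun s t => Fin.partialSum a 1 - Fin.partialSum a 0 + s - t)
    (β.face₂_left (Δ := op ⦋2⦌) x 0 0 le_rfl le_rfl)
    (β.face₂_left (Δ := op ⦋2⦌) x 0 1 le_rfl (by decide))).trans ?_
  simp [Fin.partialSum, pair]

theorem δ_one_pair (a : Fin 2 → A) (x : M _⦋2⦌) :
    β.twistedProduct.δ 1 (β.pair (Δ := op ⦋2⦌) a x) =
      β.pair (Δ := op ⦋1⦌) (fun _ => a 0 + a 1) (M.δ 1 x) := by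
  refine Prod.ext (funext fun i => ?_) rfl
  fin_cases i
  refine (congrArg₂ (fun s t => Fin.partialSum a 2 - Fin.partialSum a 0 + s - t)
    (β.face₂_left (Δ := op ⦋2⦌) x 0 0 le_rfl le_rfl)
    (β.face₂_left (Δ := op ⦋2⦌) x 0 2 le_rfl (by decide))).trans ?_
  simp [Fin.partialSum, pair]

theorem δ_zero_pair (a : Fin 2 → A) (x : M _⦋2⦌) :
    β.twistedProduct.δ 0 (β.pair (Δ := op ⦋2⦌) a x) =
      β.pair (Δ := op ⦋1⦌) (fun _ => a 1 - β.toFun x) (M.δ 0 x) := by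
  refine Prod.ext (funext fun i => ?_) rfl
  fin_cases i
  have hx : face₂ (Δ := op ⦋2⦌) x 0 1 2 (by decide) (by decide) = x := by
    have h : (SimplexCategory.mkOfLeComp (n := 2) 0 1 2 (by decide) (by decide)) = 𝟙 ⦋2⦌ := by
      ext t : 3
      fin_cases t <;> rfl
    unfold face₂
    rw [h]; simp
  refine (congrArg₂ (fun s t => Fin.partialSum a 2 - Fin.partialSum a 1 + s - t)
    (β.face₂_right (Δ := op ⦋2⦌) x 0 1 (by decide) le_rfl) (congrArg β.toFun hx)).trans ?_
  simp [Fin.partialSum, pair]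

end NormalizedCocycle
end Twisted

/-! ### The Borel construction -/

section Borel

variable {G : Type u} [Group G]

/-- The action of `g` on a simplex of a simplicial `G`-set. -/
def act (X : Action SSet.{u} G) (g : G) {Δ : SimplexCategoryᵒᵖ} (x : X.V.obj Δ) : X.V.obj Δ :=
  (X.ρ g).app Δ x

theorem act_one (X : Action SSet.{u} G) {Δ : SimplexCategoryᵒᵖ} (x : X.V.obj Δ) :
    act X 1 x = x :=
  ConcreteCategory.congr_hom (congrArg (fun h => NatTrans.app h Δ) X.ρ.map_one) x

theorem act_mul (X : Action SSet.{u} G) (g h : G) {Δ : SimplexCategoryᵒᵖ} (x : X.V.obj Δ) :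
    act X (g * h) x = act X g (act X h x) :=
  ConcreteCategory.congr_hom (congrArg (fun h => NatTrans.app h Δ) (X.ρ.map_mul g h)) x

theorem act_map (X : Action SSet.{u} G) (g : G) {Δ Δ' : SimplexCategoryᵒᵖ} (f : Δ ⟶ Δ')
    (x : X.V.obj Δ) : act X g (X.V.map f x) = X.V.map f (act X g x) :=
  NatTrans.naturality_apply (X.ρ g) f x

variable (G) in
/-- The simplicial `G`-set `EG`, with `n`-simplices `G^{n+1}`, written in the homogeneous
coordinates `h_i = g_0 g_1 ⋯ g_i`: the face `d_i` omits `h_i`, the degeneracy `s_j` repeats `h_j`,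
and `G` acts by left multiplication on all entries (that is, on `g_0` only). -/
def EG : Action SSet.{u} G where
  V :=
    { obj := fun Δ => Fin (Δ.unop.len + 1) → G
      map := fun f => ↾fun h i => h (f.unop.toOrderHom i) }
  ρ :=
    { toFun := fun g => { app := fun _ => ↾fun h i => g * h i }
      map_one' := by
        apply SSet.hom_ext
        intro Δ
        apply ConcreteCategory.hom_ext
        intro h
        exact funext fun i => one_mul _
      map_mul' := fun g g' => by
        apply SSet.hom_ext
        intro Δ
        apply ConcreteCategory.hom_ext
        intro h
        exact funext fun i => mul_assoc _ _ _ }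

/-- The orbit relation of the diagonal action on `(EG)_n × X_n`. -/
def borelSetoid (X : Action SSet.{u} G) (Δ : SimplexCategoryᵒᵖ) :
    Setoid ((EG G).V.obj Δ × X.V.obj Δ) where
  r z z' := ∃ g : G, z' = (act (EG G) g z.1, act X g z.2)
  iseqv :=
    { refl := fun z => ⟨1, by rw [act_one, act_one]⟩
      symm := by
        rintro z z' ⟨g, rfl⟩
        exact ⟨g⁻¹, by simp only [← act_mul, inv_mul_cancel, act_one]⟩
      trans := by
        rintro z z' z'' ⟨g, rfl⟩ ⟨g', rfl⟩
        exact ⟨g' * g, by simp only [act_mul]⟩ }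

/-- The Borel construction `X // G = EG ×_G X`. -/
def borel (X : Action SSet.{u} G) : SSet.{u} where
  obj Δ := Quotient (borelSetoid X Δ)
  map {Δ Δ'} f := ↾(Quotient.map (sa := borelSetoid X Δ) (sb := borelSetoid X Δ')
    (fun z => ((EG G).V.map f z.1, X.V.map f z.2)) (by
      rintro z z' ⟨g, rfl⟩
      exact ⟨g, by rw [act_map, act_map]⟩))
  map_id Δ := by
    apply ConcreteCategory.hom_ext
    rintro ⟨h, x⟩
    refine congrArg (Quotient.mk (borelSetoid X Δ)) (Prod.ext rfl ?_)
    exact ConcreteCategory.congr_hom (X.V.map_id Δ) x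
  map_comp {Δ Δ' Δ''} f g := by
    apply ConcreteCategory.hom_ext
    rintro ⟨h, x⟩
    refine congrArg (Quotient.mk (borelSetoid X Δ'')) (Prod.ext rfl ?_)
    exact ConcreteCategory.congr_hom (X.V.map_comp f g) x

/-- The simplex `[h, x]` of the Borel construction. -/
def borelMk (X : Action SSet.{u} G) {Δ : SimplexCategoryᵒᵖ} (h : Fin (Δ.unop.len + 1) → G)
    (x : X.V.obj Δ) : (borel X).obj Δ :=
  Quotient.mk (borelSetoid X Δ) (h, x)

theorem borelMk_eq_iff (X : Action SSet.{u} G) {Δ : SimplexCategoryᵒᵖ}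
    {h h' : Fin (Δ.unop.len + 1) → G} {x x' : X.V.obj Δ} :
    borelMk X h x = borelMk X h' x' ↔ ∃ g : G, (∀ i, h' i = g * h i) ∧ x' = act X g x := by
  constructor
  · intro e
    obtain ⟨g, hg⟩ := Quotient.exact (s := borelSetoid X Δ) e
    exact ⟨g, fun i => congrFun (congrArg Prod.fst hg) i, congrArg Prod.snd hg⟩
  · rintro ⟨g, h1, rfl⟩
    exact Quotient.sound (s := borelSetoid X Δ) ⟨g, Prod.ext (funext h1) rfl⟩

theorem borel_δ (X : Action SSet.{u} G) {n : ℕ} (i : Fin (n + 2)) (h : Fin (n + 2) → G)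
    (x : X.V _⦋n + 1⦌) :
    (borel X).δ i (borelMk X (Δ := op ⦋n + 1⦌) h x) =
      borelMk X (Δ := op ⦋n⦌) (fun j => h (i.succAbove j)) (X.V.δ i x) := rfl

end Borel

/-! ### Group actions on central extensions and the class `[β_G]` -/

section Extension

variable {A : Type u} [AddCommGroup A] {M : SSet.{u}} [IsPartialMonoid M]

/-- An action of `G` on the total space `E = NA ×_β M` of a central extension, by automorphisms
that fix `NA` and commute with the action of `NA` on `E`. -/
structure FibreAction (β : NormalizedCocycle M A) (G : Type u) [Group G] where
  φ : G →* Aut β.twistedProduct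
  fixes : ∀ (g : G) (Δ : SimplexCategoryᵒᵖ) (a : (nerveSSet A).obj Δ),
    (φ g).hom.app Δ (β.incl.app Δ a) = β.incl.app Δ a
  commutes : ∀ (g : G) (Δ : SimplexCategoryᵒᵖ) (a : Fin Δ.unop.len → A)
    (e : β.twistedProduct.obj Δ),
    (φ g).hom.app Δ (β.translate a e) = β.translate a ((φ g).hom.app Δ e)

namespace FibreAction

variable {β : NormalizedCocycle M A} {G : Type u} [Group G] (S : FibreAction β G)

/-- The total space `E` as a simplicial `G`-set. -/
abbrev total : Action SSet.{u} G where
  V := β.twistedProduct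
  ρ := (Aut.toEnd β.twistedProduct).comp S.φ

theorem act_translate (g : G) {Δ : SimplexCategoryᵒᵖ} (a : Fin Δ.unop.len → A)
    (e : β.twistedProduct.obj Δ) :
    act S.total g (β.translate a e : β.twistedProduct.obj Δ) =
      β.translate a (act S.total g e) :=
  S.commutes g Δ a e

/-- The projection of `g • e` to `M` depends only on the projection of `e`. -/
theorem act_snd (g : G) {Δ : SimplexCategoryᵒᵖ} (e : β.twistedProduct.obj Δ) :
    (act S.total g e : β.twistedProduct.obj Δ).2 =
      (act S.total g (β.eta e.2) : β.twistedProduct.obj Δ).2 := by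
  conv_lhs => rw [← β.translate_eta e, act_translate]
  rfl

/-- The induced action on the base, making `π : E → M` equivariant. -/
abbrev base : Action SSet.{u} G where
  V := M
  ρ :=
    { toFun := fun g =>
        { app := fun Δ => ↾fun x => (act S.total g (β.eta x) : β.twistedProduct.obj Δ).2
          naturality := by
            intro Δ Δ' f
            apply ConcreteCategory.hom_ext
            intro x
            have h := act_map S.total g f (β.eta x)
            have h2 := act_snd S g (β.twistedProduct.map f (β.eta x))
            exact h2.symm.trans (congrArg Prod.snd h) }
      map_one' := by
        apply SSet.hom_ext
        intro Δ
        apply ConcreteCategory.hom_ext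
        intro x
        exact congrArg Prod.snd (act_one S.total (β.eta x))
      map_mul' := fun g g' => by
        apply SSet.hom_ext
        intro Δ
        apply ConcreteCategory.hom_ext
        intro x
        exact (congrArg Prod.snd (act_mul S.total g g' (β.eta x))).trans
          (act_snd S g (act S.total g' (β.eta x))) }

/-- The projection `π : E → M` as a map of simplicial `G`-sets. -/
def projHom : S.total ⟶ S.base where
  hom := β.proj
  comm g := by
    ext Δ e
    exact act_snd S g e

/-- The fibre inclusion `i : NA → E` as a map of simplicial `G`-sets, with trivial action on
`NA`. -/
noncomputable def inclHom : Action.trivial G (nerveSSet A) ⟶ S.total where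
  hom := β.incl
  comm g := by
    ext Δ a
    exact (S.fixes g Δ a).symm

/-- The action of `NA` on `E // G`. -/
def borelTranslate {Δ : SimplexCategoryᵒᵖ} (a : Fin Δ.unop.len → A) :
    (borel S.total).obj Δ → (borel S.total).obj Δ :=
  Quotient.map (sa := borelSetoid S.total Δ) (sb := borelSetoid S.total Δ)
    (fun z => (z.1, β.translate a z.2)) (by
      rintro z z' ⟨g, rfl⟩
      exact ⟨g, Prod.ext rfl (S.act_translate g a z.2).symm⟩)

/-- The pseudo-section `η_G : M // G → E // G`,
`[(1, g_1, …, g_n), x] ↦ [(1, g_1, …, g_n), η(x)]`. -/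
def etaG {Δ : SimplexCategoryᵒᵖ} : (borel S.base).obj Δ → (borel S.total).obj Δ :=
  Quotient.lift (s := borelSetoid S.base Δ)
    (fun z => borelMk S.total (fun i => (z.1 0)⁻¹ * z.1 i) (β.eta (act S.base (z.1 0)⁻¹ z.2))) (by
      rintro z z' ⟨g, rfl⟩
      have h1 : ∀ i, (act (EG G) g z.1 : Fin (Δ.unop.len + 1) → G) i = g * z.1 i := fun _ => rfl
      simp only [h1, ← act_mul]
      simp [mul_assoc])


/-- `Φ_g(x)`, determined by `g • η(g⁻¹ • x) = (Φ_g(x), x)`. -/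
def Phi (g : G) (x : M _⦋1⦌) : A :=
  (act S.total g (β.eta (act S.base g⁻¹ x : M _⦋1⦌)) : β.twistedProduct _⦋1⦌).1 0

theorem act_eta (g : G) {Δ : SimplexCategoryᵒᵖ} (x : M.obj Δ) :
    (act S.total g (β.eta x) : β.twistedProduct.obj Δ).2 = act S.base g x := rfl

theorem act_eta_inv (g : G) (x : M _⦋1⦌) :
    act S.total g (β.eta (act S.base g⁻¹ x : M _⦋1⦌)) =
      β.pair (Δ := op ⦋1⦌) (fun _ => S.Phi g x) x := by
  refine Prod.ext (funext fun i => ?_) ?_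
  · fin_cases i
    rfl
  · refine (S.act_eta g (act S.base g⁻¹ x : M _⦋1⦌)).trans ?_
    refine (act_mul S.base g g⁻¹ (x : S.base.V _⦋1⦌)).symm.trans ?_
    rw [mul_inv_cancel]
    exact act_one S.base (x : S.base.V _⦋1⦌)

theorem act_pair_inv (g : G) (a : A) (x : M _⦋1⦌) :
    act S.total g (β.pair (Δ := op ⦋1⦌) (fun _ => a) (act S.base g⁻¹ x : M _⦋1⦌)) =
      β.pair (Δ := op ⦋1⦌) (fun _ => a + S.Phi g x) x := by
  have h := S.act_translate g (Δ := op ⦋1⦌) (fun _ => a) (β.eta (act S.base g⁻¹ x : M _⦋1⦌))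
  rw [act_eta_inv] at h
  refine Eq.trans ?_ h
  exact congrArg (act S.total g) (Prod.ext (funext fun _ => (add_zero a).symm) rfl)

theorem Phi_mul (g k : G) (x : M _⦋1⦌) :
    S.Phi (g * k) x = S.Phi g x + S.Phi k (act S.base g⁻¹ x : M _⦋1⦌) := by
  have h1 := S.act_eta_inv (g * k) x
  rw [act_mul, mul_inv_rev] at h1
  have h2 : (act S.base (k⁻¹ * g⁻¹) x : M _⦋1⦌) = act S.base k⁻¹ (act S.base g⁻¹ x : M _⦋1⦌) :=
    act_mul S.base _ _ _
  rw [h2, act_eta_inv, act_pair_inv] at h1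
  have h3 : S.Phi k (act S.base g⁻¹ x : M _⦋1⦌) + S.Phi g x = S.Phi (g * k) x :=
    congrFun (congrArg Prod.fst h1) 0
  rw [← h3, add_comm]

theorem Phi_faces (g : G) (y : M _⦋2⦌) :
    β.toFun (act S.base g⁻¹ y : M _⦋2⦌) + S.Phi g (M.δ 1 y) =
      S.Phi g (M.δ 2 y) + S.Phi g (M.δ 0 y) + β.toFun y := by
  set y' : M _⦋2⦌ := act S.base g⁻¹ y with hy'
  have hδ : ∀ i : Fin 3, M.δ i y' = (act S.base g⁻¹ (M.δ i y) : M _⦋1⦌) := fun i =>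
    (act_map S.base g⁻¹ (SimplexCategory.δ i).op y).symm
  obtain ⟨b, hb⟩ : ∃ b : Fin 2 → A, act S.total g
      (β.pair (Δ := op ⦋2⦌) (![0, β.toFun y'] : Fin 2 → A) y') = β.pair (Δ := op ⦋2⦌) b y := by
    refine ⟨(act S.total g (β.pair (Δ := op ⦋2⦌) (![0, β.toFun y'] : Fin 2 → A) y') :
      β.twistedProduct _⦋2⦌).1, Prod.ext rfl ?_⟩
    refine (S.act_snd g _).trans ?_
    refine (S.act_eta g y').trans ?_
    rw [hy']
    refine (act_mul S.base g g⁻¹ (y : S.base.V _⦋2⦌)).symm.trans ?_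
    rw [mul_inv_cancel]
    exact act_one S.base (y : S.base.V _⦋2⦌)
  have key : ∀ i : Fin 3, β.twistedProduct.δ i (β.pair (Δ := op ⦋2⦌) b y) =
      act S.total g (β.twistedProduct.δ i
        (β.pair (Δ := op ⦋2⦌) (![0, β.toFun y'] : Fin 2 → A) y')) := fun i => by
    rw [← hb]
    exact (act_map S.total g (SimplexCategory.δ i).op _).symm
  have k2 := key 2
  have k1 := key 1
  have k0 := key 0
  rw [β.δ_two_pair, β.δ_two_pair, hδ, act_pair_inv] at k2
  rw [β.δ_one_pair, β.δ_one_pair, hδ, act_pair_inv] at k1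
  rw [β.δ_zero_pair, β.δ_zero_pair, hδ, act_pair_inv] at k0
  have e2 : b 0 = 0 + S.Phi g (M.δ 2 y) := congrFun (congrArg Prod.fst k2) 0
  have e1 : b 0 + b 1 = 0 + β.toFun y' + S.Phi g (M.δ 1 y) := congrFun (congrArg Prod.fst k1) 0
  have e0 : b 1 - β.toFun y = β.toFun y' - β.toFun y' + S.Phi g (M.δ 0 y) :=
    congrFun (congrArg Prod.fst k0) 0
  rw [sub_self, zero_add, sub_eq_iff_eq_add] at e0
  rw [zero_add] at e1 e2
  rw [← e1, e2, e0]
  abel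

/-- `IsBetaG z a` says that `η_G(x) · η_G(y) = a · η_G(x · y)` in `E // G`, where
`z = (x, y) ∈ (M // G)_2`. -/
def IsBetaG (z : (borel S.base) _⦋2⦌) (a : A) : Prop :=
  IsProduct (borel S.total) (S.etaG ((borel S.base).δ 2 z)) (S.etaG ((borel S.base).δ 0 z))
    (S.borelTranslate (Δ := op ⦋1⦌) (fun _ => a) (S.etaG ((borel S.base).δ 1 z)))

theorem exists_normal {X : Action SSet.{u} G} {Δ : SimplexCategoryᵒᵖ} (z : (borel X).obj Δ) :
    ∃ (h : Fin (Δ.unop.len + 1) → G) (x : X.V.obj Δ), h 0 = 1 ∧ z = borelMk X h x := by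
  obtain ⟨h, x⟩ := z
  refine ⟨fun i => (h 0)⁻¹ * h i, act X (h 0)⁻¹ x, inv_mul_cancel _, ?_⟩
  exact (borelMk_eq_iff X).2 ⟨(h 0)⁻¹, fun _ => rfl, rfl⟩

theorem etaG_mk {Δ : SimplexCategoryᵒᵖ} (h : Fin (Δ.unop.len + 1) → G) (x : M.obj Δ) :
    S.etaG (borelMk S.base h x) =
      borelMk S.total h (act S.total (h 0) (β.eta (act S.base (h 0)⁻¹ x : M.obj Δ))) :=
  (borelMk_eq_iff S.total).2 ⟨h 0, fun _ => (mul_inv_cancel_left _ _).symm, rfl⟩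

theorem isBetaG_iff (h : Fin 3 → G) (h0 : h 0 = 1) (x : M _⦋2⦌) (a : A) :
    S.IsBetaG (borelMk S.base (Δ := op ⦋2⦌) h x) a ↔
      a = β.toFun x + S.Phi (h 1) (M.δ 0 x) := by
  -- the three faces of `[h, x]` under `η_G`
  have e2 : S.etaG ((borel S.base).δ 2 (borelMk S.base (Δ := op ⦋2⦌) h x)) =
      borelMk S.total (Δ := op ⦋1⦌) ![h 0, h 1] (β.pair (Δ := op ⦋1⦌) (fun _ => 0) (M.δ 2 x)) := by
    have hh : (fun j => h ((2 : Fin 3).succAbove j)) = ![h 0, h 1] := by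
      funext j; fin_cases j <;> rfl
    rw [borel_δ, hh]
    refine (S.etaG_mk (Δ := op ⦋1⦌) ![h 0, h 1] (M.δ 2 x)).trans ?_
    rw [show (![h 0, h 1] : Fin 2 → G) 0 = 1 from h0, inv_one, act_one, act_one]
    rfl
  have e0 : S.etaG ((borel S.base).δ 0 (borelMk S.base (Δ := op ⦋2⦌) h x)) =
      borelMk S.total (Δ := op ⦋1⦌) ![h 1, h 2]
        (β.pair (Δ := op ⦋1⦌) (fun _ => S.Phi (h 1) (M.δ 0 x)) (M.δ 0 x)) := by
    have hh : (fun j => h ((0 : Fin 3).succAbove j)) = ![h 1, h 2] := by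
      funext j; fin_cases j <;> rfl
    rw [borel_δ, hh]
    refine (S.etaG_mk (Δ := op ⦋1⦌) ![h 1, h 2] (M.δ 0 x)).trans ?_
    exact congrArg _ (S.act_eta_inv (h 1) (M.δ 0 x))
  have e1 : S.borelTranslate (Δ := op ⦋1⦌) (fun _ => a)
      (S.etaG ((borel S.base).δ 1 (borelMk S.base (Δ := op ⦋2⦌) h x))) =
      borelMk S.total (Δ := op ⦋1⦌) ![h 0, h 2] (β.pair (Δ := op ⦋1⦌) (fun _ => a) (M.δ 1 x)) := by
    have hh : (fun j => h ((1 : Fin 3).succAbove j)) = ![h 0, h 2] := by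
      funext j; fin_cases j <;> rfl
    rw [borel_δ, hh]
    refine (congrArg _ (S.etaG_mk (Δ := op ⦋1⦌) ![h 0, h 2] (M.δ 1 x))).trans ?_
    rw [show (![h 0, h 2] : Fin 2 → G) 0 = 1 from h0, inv_one, act_one, act_one]
    exact congrArg (borelMk S.total (Δ := op ⦋1⦌) _) (Prod.ext (funext fun _ => add_zero a) rfl)
  -- the three faces of a simplex of `E // G`
  have f2 : ∀ (k : Fin 3 → G) (b : Fin 2 → A) (y : M _⦋2⦌),
      (borel S.total).δ 2 (borelMk S.total (Δ := op ⦋2⦌) k (β.pair (Δ := op ⦋2⦌) b y)) =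
      borelMk S.total (Δ := op ⦋1⦌) ![k 0, k 1]
        (β.pair (Δ := op ⦋1⦌) (fun _ => b 0) (M.δ 2 y)) := by
    intro k b y
    have hh : (fun j => k ((2 : Fin 3).succAbove j)) = ![k 0, k 1] := by
      funext j; fin_cases j <;> rfl
    rw [borel_δ, β.δ_two_pair, hh]
  have f1 : ∀ (k : Fin 3 → G) (b : Fin 2 → A) (y : M _⦋2⦌),
      (borel S.total).δ 1 (borelMk S.total (Δ := op ⦋2⦌) k (β.pair (Δ := op ⦋2⦌) b y)) =
      borelMk S.total (Δ := op ⦋1⦌) ![k 0, k 2]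
        (β.pair (Δ := op ⦋1⦌) (fun _ => b 0 + b 1) (M.δ 1 y)) := by
    intro k b y
    have hh : (fun j => k ((1 : Fin 3).succAbove j)) = ![k 0, k 2] := by
      funext j; fin_cases j <;> rfl
    rw [borel_δ, β.δ_one_pair, hh]
  have f0 : ∀ (k : Fin 3 → G) (b : Fin 2 → A) (y : M _⦋2⦌),
      (borel S.total).δ 0 (borelMk S.total (Δ := op ⦋2⦌) k (β.pair (Δ := op ⦋2⦌) b y)) =
      borelMk S.total (Δ := op ⦋1⦌) ![k 1, k 2]
        (β.pair (Δ := op ⦋1⦌) (fun _ => b 1 - β.toFun y) (M.δ 0 y)) := by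
    intro k b y
    have hh : (fun j => k ((0 : Fin 3).succAbove j)) = ![k 1, k 2] := by
      funext j; fin_cases j <;> rfl
    rw [borel_δ, β.δ_zero_pair, hh]
  have heq : ∀ {k k' : Fin 2 → G} {b b' : A} {y y' : M _⦋1⦌}, k 0 = k' 0 →
      borelMk S.total (Δ := op ⦋1⦌) k (β.pair (Δ := op ⦋1⦌) (fun _ => b) y) =
      borelMk S.total (Δ := op ⦋1⦌) k' (β.pair (Δ := op ⦋1⦌) (fun _ => b') y') →
      k 1 = k' 1 ∧ b = b' ∧ y = y' := by
    intro k k' b b' y y' hk e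
    obtain ⟨g, hg, hy⟩ := (borelMk_eq_iff S.total).1 e
    have hg1 : g = 1 := by
      have := hg 0
      rw [← hk] at this
      exact (mul_eq_right.1 this.symm)
    subst hg1
    rw [act_one] at hy
    refine ⟨by rw [hg 1, one_mul], ?_, ?_⟩
    · exact (congrFun (congrArg Prod.fst hy) 0).symm
    · exact (congrArg Prod.snd hy).symm
  unfold IsBetaG IsProduct
  rw [e2, e0, e1]
  constructor
  · rintro ⟨w, w2, w0, w1⟩
    obtain ⟨k, ⟨b, y⟩, hk, rfl⟩ := exists_normal w
    rw [show ((b, y) : β.twistedProduct _⦋2⦌) = β.pair (Δ := op ⦋2⦌) b y from rfl] at w2 w1 w0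
    rw [f2] at w2
    rw [f1] at w1
    rw [f0] at w0
    obtain ⟨q1, q2, q3⟩ := heq (hk.trans h0.symm) w2
    obtain ⟨r1, r2, r3⟩ := heq q1 w0
    obtain ⟨t1, t2, t3⟩ := heq (hk.trans h0.symm) w1
    have hyx : y = x := by
      apply IsPartialMonoid.spine_injective (M := M) 2 (by norm_num)
      funext i
      fin_cases i
      · have hm : SimplexCategory.mkOfSucc (0 : Fin 2) = SimplexCategory.δ 2 := by
          ext t : 3
          fin_cases t <;> rfl
        exact (congrArg (fun f => M.map (Quiver.Hom.op f) y) hm).trans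
          (q3.trans (congrArg (fun f => M.map (Quiver.Hom.op f) x) hm).symm)
      · have hm : SimplexCategory.mkOfSucc (1 : Fin 2) = SimplexCategory.δ 0 := by
          ext t : 3
          fin_cases t <;> rfl
        exact (congrArg (fun f => M.map (Quiver.Hom.op f) y) hm).trans
          (r3.trans (congrArg (fun f => M.map (Quiver.Hom.op f) x) hm).symm)
    subst hyx
    rw [← t2, q2, zero_add, ← r2]
    abel
  · rintro rfl
    refine ⟨borelMk S.total (Δ := op ⦋2⦌) h (β.pair (Δ := op ⦋2⦌)
      (![0, β.toFun x + S.Phi (h 1) (M.δ 0 x)] : Fin 2 → A) x), ?_, ?_, ?_⟩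
    · rw [f2]; rfl
    · rw [f0]; simp
    · rw [f1]; simp

theorem exists_isBetaG (z : (borel S.base) _⦋2⦌) : ∃ a : A, S.IsBetaG z a := by
  obtain ⟨h, x, h0, rfl⟩ := exists_normal z
  exact ⟨_, (S.isBetaG_iff h h0 x _).2 rfl⟩

/-- The cocycle `β_G : (M // G)_2 → A`, `β_G(x, y) = η_G(x) · η_G(y) · η_G(x · y)⁻¹`. -/
noncomputable def betaG (z : (borel S.base) _⦋2⦌) : A :=
  (S.exists_isBetaG z).choose

theorem betaG_mk (h : Fin 3 → G) (h0 : h 0 = 1) (x : M _⦋2⦌) :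
    S.betaG (borelMk S.base (Δ := op ⦋2⦌) h x) = β.toFun x + S.Phi (h 1) (M.δ 0 x) :=
  (S.isBetaG_iff h h0 x _).1 (S.exists_isBetaG _).choose_spec

theorem betaG_mem_ker : S.betaG ∈ (coboundary (borel S.base) A 2).ker := by
  refine funext fun z => ?_
  obtain ⟨h, x, h0, rfl⟩ := exists_normal z
  have d0 : (borel S.base).δ 0 (borelMk S.base (Δ := op ⦋3⦌) h x) =
      borelMk S.base (Δ := op ⦋2⦌) ![1, (h 1)⁻¹ * h 2, (h 1)⁻¹ * h 3]
        (act S.base (h 1)⁻¹ (M.δ 0 x) : M _⦋2⦌) := by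
    rw [borel_δ]
    refine (borelMk_eq_iff S.base).2 ⟨(h 1)⁻¹, fun j => ?_, rfl⟩
    fin_cases j
    · exact (inv_mul_cancel (h 1)).symm
    · rfl
    · rfl
  have d1 : (borel S.base).δ 1 (borelMk S.base (Δ := op ⦋3⦌) h x) =
      borelMk S.base (Δ := op ⦋2⦌) ![h 0, h 2, h 3] (M.δ 1 x) := by
    rw [borel_δ]
    congr 1
    funext j; fin_cases j <;> rfl
  have d2 : (borel S.base).δ 2 (borelMk S.base (Δ := op ⦋3⦌) h x) =
      borelMk S.base (Δ := op ⦋2⦌) ![h 0, h 1, h 3] (M.δ 2 x) := by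
    rw [borel_δ]
    congr 1
    funext j; fin_cases j <;> rfl
  have d3 : (borel S.base).δ 3 (borelMk S.base (Δ := op ⦋3⦌) h x) =
      borelMk S.base (Δ := op ⦋2⦌) ![h 0, h 1, h 2] (M.δ 3 x) := by
    rw [borel_δ]
    congr 1
    funext j; fin_cases j <;> rfl
  have b0 := S.betaG_mk ![1, (h 1)⁻¹ * h 2, (h 1)⁻¹ * h 3] rfl
    (act S.base (h 1)⁻¹ (M.δ 0 x) : M _⦋2⦌)
  have b1 := S.betaG_mk ![h 0, h 2, h 3] h0 (M.δ 1 x)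
  have b2 := S.betaG_mk ![h 0, h 1, h 3] h0 (M.δ 2 x)
  have b3 := S.betaG_mk ![h 0, h 1, h 2] h0 (M.δ 3 x)
  rw [← d0] at b0
  rw [← d1] at b1
  rw [← d2] at b2
  rw [← d3] at b3
  have hM : M.δ 0 (act S.base (h 1)⁻¹ (M.δ 0 x) : M _⦋2⦌) =
      (act S.base (h 1)⁻¹ (M.δ 0 (M.δ 0 x)) : M _⦋1⦌) :=
    (act_map S.base (h 1)⁻¹ (SimplexCategory.δ 0).op (M.δ 0 x)).symm
  have s1 : M.δ 0 (M.δ 1 x) = M.δ 0 (M.δ 0 x) :=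
    (SSet.δ_comp_δ_self_apply (S := M) (n := 1) (i := 0) x).symm
  have s2 : M.δ 0 (M.δ 2 x) = M.δ 1 (M.δ 0 x) :=
    SSet.δ_comp_δ_apply (S := M) (n := 1) (i := 0) (j := 1) (by decide) x
  have s3 : M.δ 0 (M.δ 3 x) = M.δ 2 (M.δ 0 x) :=
    SSet.δ_comp_δ_apply (S := M) (n := 1) (i := 0) (j := 2) (by decide) x
  have hPhi := S.Phi_mul (h 1) ((h 1)⁻¹ * h 2) (M.δ 0 (M.δ 0 x))
  rw [mul_inv_cancel_left] at hPhi
  have hF := S.Phi_faces (h 1) (M.δ 0 x)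
  have hc := β.cocycle x
  change ∑ i : Fin 4, (-1 : ℤ) ^ (i : ℕ) • S.betaG ((borel S.base).δ i _) = 0
  rw [Fin.sum_univ_four, b0, b1, b2, b3, hM, s1, s2, s3]
  simp only [Matrix.cons_val_one, Matrix.cons_val_zero, hPhi]
  rw [← eq_sub_iff_add_eq] at hF hc
  rw [hF, hc]
  simp
  abel

/-- The class `[β_G] ∈ H^2(M // G, A)`. -/
noncomputable def betaGClass : H2 (borel S.base) A :=
  QuotientAddGroup.mk ⟨S.betaG, S.betaG_mem_ker⟩

end FibreAction
end Extension
end EquivariantContextuality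

open EquivariantContextuality

/-! ### From noncontextual distributions to equivariant retractions -/

namespace EquivariantContextuality

/-! Suppose a relative `p` were a mixture `∑ d(q) q` of deterministic distributions `q = δ ∘ s_q`.
Restricting to `NA` gives `∑ d(q) δ_{s_q(i(a))} = δ_a` for each simplex `a`. No cancellation is
possible in a zero-sum-free semiring, so every `q` with `d(q) ≠ 0` satisfies `s_q(i(a)) = a`. Such a
`q` exists because the total mass is `1 ≠ 0`. Hence `s_q` is an equivariant retraction of `i`
(`exists_retraction_of_isRelative_comparison`).

An equivariant retraction `s : E → NA` trivializes `[β_G]`. On edges `s` is additive along products,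
so `s(a, x) = a + f(x)` with `f(x) = s(0, x)` (`edgeValue_pair`). Additivity on a lift of a
`2`-simplex `x` of `M` then gives `β(x) = f(d₂ x) + f(d₀ x) - f(d₁ x)` (`toFun_eq_edgeValue`), and
invariance of `s` under `G` gives `Φ_g(x) = f(g⁻¹ x) - f(x)` (`Phi_eq_edgeValue`).

By `betaG_mk`, `β_G` takes the value `β(x) + Φ_{h₁}(d₀ x)` at `[h, x]` with `h₀ = 1`. Substituting,
the two terms `f(d₀ x)` cancel, and what remains is the coboundary of the cochain `F[h, x] = f(h₀⁻¹
x)` on `M // G` (`betaGClass_eq_zero`). This contradicts `[β_G] ≠ 0`. -/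

/-- In a zero-sum-free semiring, a mixture of delta-distributions that is itself the
delta-distribution at `u` has all its mass on the delta-distribution at `u`. -/
theorem Dist.eq_of_mix_delta_eq_delta {R : Type*} [CommSemiring R]
    (zero_sum_free : ∀ a b : R, a + b = 0 → a = 0 ∧ b = 0) {T U : Type*} (d : Dist R T)
    (f : T → U) {u : U} (h : (d.mix fun t => Dist.delta R (f t)) = Dist.delta R u) {t : T}
    (ht : d.1 t ≠ 0) : f t = u := by
  classical
  by_contra hne
  -- Both sides of `h` are evaluated at the point `f t`, where the delta-distribution at `u ≠ f t`
  -- vanishes. The summand of index `t` there is `d(t)`, and zero-sum-freeness forces it to be `0`.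
  have h0 : (∑ t' ∈ d.1.support, d.1 t' * (Finsupp.single (f t') (1 : R)) (f t)) = 0 := by
    have h1 := DFunLike.congr_fun (congrArg Subtype.val h) (f t)
    simp only [Dist.mix, Dist.delta, Finsupp.sum, Finsupp.finsetSum_apply, Finsupp.smul_apply,
      smul_eq_mul] at h1
    rw [h1, Finsupp.single_eq_of_ne hne]
  rw [← Finset.add_sum_erase _ _ (Finsupp.mem_support_iff.2 ht)] at h0
  have h2 := (zero_sum_free _ _ h0).1
  rw [Finsupp.single_eq_same, mul_one] at h2
  exact ht h2

theorem Dist.exists_ne_zero {R : Type*} [CommSemiring R] [Nontrivial R] {T : Type*}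
    (d : Dist R T) : ∃ t, d.1 t ≠ 0 := by
  by_contra! h
  have hd := d.2
  rw [show d.1 = 0 from Finsupp.ext h, Finsupp.sum_zero_index] at hd
  exact zero_ne_one hd

theorem comparison_at {R G : Type u} [CommSemiring R] [Group G] {X Y : Action SSet.{u} G}
    (d : Dist R (DDist R X Y)) {Δ : SimplexCategoryᵒᵖ} (σ : X.V.obj Δ) :
    (comparison d).at σ = d.mix fun q => q.1.at σ := rfl

theorem SDist.at_comp_deltaHom {R G : Type u} [CommSemiring R] [Group G] {X Y : Action SSet.{u} G}
    (s : X ⟶ Y) {Δ : SimplexCategoryᵒᵖ} (σ : X.V.obj Δ) :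
    SDist.at (R := R) (s ≫ deltaHom R Y) σ = Dist.delta R (s.hom.app Δ σ) := rfl

theorem IsRelative.at_hom {R G : Type u} [CommSemiring R] [Group G] {X Y : Action SSet.{u} G}
    (i : Y ⟶ X) (p : SDist R X Y) (hp : IsRelative i p) {Δ : SimplexCategoryᵒᵖ} (y : Y.V.obj Δ) :
    p.at (i.hom.app Δ y) = Dist.delta R y :=
    ConcreteCategory.congr_hom
      (congrArg (fun h : Y ⟶ distAction R Y => NatTrans.app h.hom Δ) hp) y

/-- If `∑ d(q) q` is relative to `i : Y → X`, then some equivariant map `X → Y` is a retraction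
of `i`. -/
theorem exists_retraction_of_isRelative_comparison {R G : Type u} [CommSemiring R] [Nontrivial R]
    [Group G] (zero_sum_free : ∀ a b : R, a + b = 0 → a = 0 ∧ b = 0) {X Y : Action SSet.{u} G}
    (i : Y ⟶ X) (d : Dist R (DDist R X Y)) (hd : IsRelative i (comparison d)) :
    ∃ s : X ⟶ Y, ∀ {Δ : SimplexCategoryᵒᵖ} (y : Y.V.obj Δ),
      s.hom.app Δ (i.hom.app Δ y) = y := by
  -- `r q` is a simplicial map underlying `q`, so that the mixture becomes one of
  -- delta-distributions. Any `q` of nonzero weight then supplies the retraction, and the same `q`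
  -- serves in every simplicial degree.
  choose r hr using fun q : DDist R X Y => q.2
  obtain ⟨q, hq⟩ := d.exists_ne_zero
  refine ⟨r q, fun {Δ} y => ?_⟩
  have h := IsRelative.at_hom i _ hd y
  rw [comparison_at] at h
  simp only [hr, SDist.at_comp_deltaHom] at h
  exact Dist.eq_of_mix_delta_eq_delta zero_sum_free d _ h hq

/-! ### An equivariant retraction onto the fibre trivializes the class of `β_G` -/

namespace FibreAction

variable {A G : Type u} [AddCommGroup A] [Group G] {M : SSet.{u}} [IsPartialMonoid M]
  {β : NormalizedCocycle M A} {S : FibreAction β G}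

/-- The value in `A` of `s : E → NA` at the `1`-simplex `e`. -/
def edgeValue (s : S.total ⟶ Action.trivial G (nerveSSet A)) (e : β.twistedProduct _⦋1⦌) : A :=
  (s.hom.app (op ⦋1⦌) e : Fin 1 → A) 0

/-- The product of edges in `NA` is addition in `A`: each face is a difference of partial sums, and
these telescope. -/
theorem nerveSSet_faces (c : Fin 2 → A) :
    ((nerveSSet A).δ (n := 1) 2 c : Fin 1 → A) 0 + ((nerveSSet A).δ (n := 1) 0 c : Fin 1 → A) 0 =
      ((nerveSSet A).δ (n := 1) 1 c : Fin 1 → A) 0 := by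
  have h2 : ((nerveSSet A).δ (n := 1) 2 c : Fin 1 → A) 0 =
    Fin.partialSum c 1 - Fin.partialSum c 0 := rfl
  have h0 : ((nerveSSet A).δ (n := 1) 0 c : Fin 1 → A) 0 =
    Fin.partialSum c 2 - Fin.partialSum c 1 := rfl
  have h1 : ((nerveSSet A).δ (n := 1) 1 c : Fin 1 → A) 0 =
    Fin.partialSum c 2 - Fin.partialSum c 0 := rfl
  rw [h2, h0, h1]
  abel

theorem edgeValue_faces (s : S.total ⟶ Action.trivial G (nerveSSet A))
    (w : β.twistedProduct _⦋2⦌) :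
    edgeValue s (β.twistedProduct.δ 2 w) + edgeValue s (β.twistedProduct.δ 0 w) =
      edgeValue s (β.twistedProduct.δ 1 w) := by
  have hs : ∀ i : Fin 3, edgeValue s (β.twistedProduct.δ i w) =
      ((nerveSSet A).δ (n := 1) i (s.hom.app (op ⦋2⦌) w) : Fin 1 → A) 0 := fun i =>
    congrFun (NatTrans.naturality_apply s.hom (SimplexCategory.δ i).op w) 0
  rw [hs, hs, hs]
  exact nerveSSet_faces _

/-- The action on `NA` is trivial, so equivariance of `s` amounts to invariance. -/
theorem edgeValue_act (s : S.total ⟶ Action.trivial G (nerveSSet A)) (g : G)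
    (e : β.twistedProduct _⦋1⦌) : edgeValue s (act S.total g e) = edgeValue s e :=
  congrFun (ConcreteCategory.congr_hom
    (congrArg (fun h => NatTrans.app h (op ⦋1⦌)) (s.comm g)) e) 0

/-- Identifies the base component of an edge of the fibre, defined through a constant map, with the
degenerate edge: both restrict the vertex along the only map `[1] → [0]`. -/
theorem incl_edge (a : A) : β.incl.app (op ⦋1⦌) (fun _ => a : Fin 1 → A) =
    β.pair (Δ := op ⦋1⦌) (fun _ => a) (M.σ 0 (vertex M)) := by
  refine Prod.ext rfl ?_
  change M.map _ (vertex M) = M.map _ (vertex M)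
  congr 3
  apply Quiver.Hom.unop_inj
  ext t : 3
  fin_cases t <;> rfl

/-- A map `E → NA` that restricts to the identity on the edges of `NA` commutes with translation. -/
theorem edgeValue_pair {s : S.total ⟶ Action.trivial G (nerveSSet A)}
    (hs : ∀ a : A, edgeValue s (β.incl.app (op ⦋1⦌) (fun _ => a : Fin 1 → A)) = a)
    (a : A) (x : M _⦋1⦌) :
    edgeValue s (β.pair (Δ := op ⦋1⦌) (fun _ => a) x) =
      a + edgeValue s (β.pair (Δ := op ⦋1⦌) (fun _ => 0) x) := by
  -- This simplex exhibits `(a, x)` as the product `(a, 1) · (0, x)`. No twist appears, because `β`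
  -- vanishes on `σ 0 x`.
  have h := edgeValue_faces s (β.pair (Δ := op ⦋2⦌) (![a, 0] : Fin 2 → A) (M.σ 0 x))
  rw [β.δ_two_pair, β.δ_one_pair, β.δ_zero_pair, β.normalized_left] at h
  have h0 : M.δ 0 (M.σ 0 x) = x := SSet.δ_comp_σ_self_apply (S := M) (i := 0) x
  have h1 : M.δ 1 (M.σ 0 x) = x := SSet.δ_comp_σ_succ_apply (S := M) (i := 0) x
  -- This face is the degenerate edge at a vertex of `x`, and `M` has only one vertex.
  have h2 : M.δ 2 (M.σ 0 x) = M.σ 0 (vertex M) := by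
    refine (SSet.δ_comp_σ_of_gt_apply (S := M) (n := 0) (i := 1) (j := 0) (by decide) x).trans ?_
    exact congrArg _ ((IsPartialMonoid.reduced (M := M)).choose_spec _)
  rw [h0, h1, h2, ← incl_edge] at h
  simp only [Matrix.cons_val_zero, Matrix.cons_val_one, add_zero, sub_zero, hs] at h
  exact h.symm

/-- The cochain `x ↦ s(0, x)` on `M` has coboundary `β`: `s` is additive on the relation `(0, x₁) ·
(0, x₂) = (β(x₁, x₂), x₁ · x₂)`. -/
theorem toFun_eq_edgeValue {s : S.total ⟶ Action.trivial G (nerveSSet A)}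
    (hs : ∀ a : A, edgeValue s (β.incl.app (op ⦋1⦌) (fun _ => a : Fin 1 → A)) = a)
    (x : M _⦋2⦌) :
    β.toFun x = edgeValue s (β.pair (Δ := op ⦋1⦌) (fun _ => 0) (M.δ 2 x)) +
      edgeValue s (β.pair (Δ := op ⦋1⦌) (fun _ => 0) (M.δ 0 x)) -
      edgeValue s (β.pair (Δ := op ⦋1⦌) (fun _ => 0) (M.δ 1 x)) := by
  -- The second entry `β(x)` cancels the twist of the `0`-th face, so that the faces `d₂` and `d₀`
  -- both have fibre coordinate `0`.
  have h := edgeValue_faces s (β.pair (Δ := op ⦋2⦌) (![0, β.toFun x] : Fin 2 → A) x)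
  rw [β.δ_two_pair, β.δ_one_pair, β.δ_zero_pair] at h
  simp only [Matrix.cons_val_zero, Matrix.cons_val_one, zero_add, sub_self] at h
  rw [h, edgeValue_pair hs (β.toFun x)]
  abel

/-- Invariance of `s` is applied to `g • (0, g⁻¹ x) = (Φ_g(x), x)`, whose value under `s` is `Φ_g(x)
+ s(0, x)`. -/
theorem Phi_eq_edgeValue {s : S.total ⟶ Action.trivial G (nerveSSet A)}
    (hs : ∀ a : A, edgeValue s (β.incl.app (op ⦋1⦌) (fun _ => a : Fin 1 → A)) = a)
    (g : G) (x : M _⦋1⦌) :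
    S.Phi g x =
      edgeValue s (β.pair (Δ := op ⦋1⦌) (fun _ => 0) (act S.base g⁻¹ x : M _⦋1⦌)) -
      edgeValue s (β.pair (Δ := op ⦋1⦌) (fun _ => 0) x) := by
  have h := edgeValue_act s g
    (β.pair (Δ := op ⦋1⦌) (fun _ => 0) (act S.base g⁻¹ x : M _⦋1⦌))
  rw [act_pair_inv, edgeValue_pair hs, zero_add] at h
  exact eq_sub_of_add_eq h

/-- An equivariant map `E → NA` that restricts to the identity on the edges of `NA` exhibits `β_G`
as a coboundary. -/
theorem betaGClass_eq_zero {s : S.total ⟶ Action.trivial G (nerveSSet A)}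
    (hs : ∀ a : A, edgeValue s (β.incl.app (op ⦋1⦌) (fun _ => a : Fin 1 → A)) = a) :
    S.betaGClass = 0 := by
  let f : M _⦋1⦌ → A := fun x => edgeValue s (β.pair (Δ := op ⦋1⦌) (fun _ => 0) x)
  -- The factor `(h 0)⁻¹` moves a representative to the one with leading entry `1`, which makes `F`
  -- constant on orbits without any invariance of `f`.
  let F : (borel S.base) _⦋1⦌ → A :=
    Quotient.lift (s := borelSetoid S.base (op ⦋1⦌))
      (fun z => f (act S.base (z.1 0)⁻¹ z.2 : M _⦋1⦌)) (by
        rintro z z' ⟨g, rfl⟩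
        have h1 : (act (EG G) g z.1 : Fin 2 → G) 0 = g * z.1 0 := rfl
        have h2 : (act S.base (g * z.1 0)⁻¹ (act S.base g z.2) : M _⦋1⦌) =
            act S.base (z.1 0)⁻¹ z.2 := by
          rw [← act_mul]
          simp
        exact (congrArg f ((congrArg (fun k : G =>
          (act S.base k⁻¹ (act S.base g z.2) : M _⦋1⦌)) h1).trans h2)).symm)
  have hF : ∀ (h : Fin 2 → G) (x : M _⦋1⦌), h 0 = 1 →
      F (borelMk S.base (Δ := op ⦋1⦌) h x) = f x := fun h x h0 => by
    change f (act S.base (h 0)⁻¹ x : M _⦋1⦌) = f x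
    rw [h0, inv_one]
    exact congrArg f (act_one S.base (x : S.base.V _⦋1⦌))
  refine (QuotientAddGroup.eq_zero_iff _).2 (AddSubgroup.mem_addSubgroupOf.2 ⟨F, ?_⟩)
  refine funext fun z => ?_
  obtain ⟨h, x, h0, rfl⟩ := exists_normal z
  refine Eq.trans ?_ (S.betaG_mk h h0 x).symm
  change ∑ i : Fin 3, (-1 : ℤ) ^ (i : ℕ) • F ((borel S.base).δ i _) = _
  -- Only the face `d₀` drops `h 0 = 1`. Its leading entry is `h 1`, and this produces the translate
  -- by `(h 1)⁻¹` that matches the term `Φ_{h 1}` of `β_G`.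
  have e0 : F ((borel S.base).δ 0 (borelMk S.base (Δ := op ⦋2⦌) h x)) =
      f (act S.base (h 1)⁻¹ (M.δ 0 x) : M _⦋1⦌) := rfl
  have e1 : F ((borel S.base).δ 1 (borelMk S.base (Δ := op ⦋2⦌) h x)) = f (M.δ 1 x) :=
    hF (fun j => h ((1 : Fin 3).succAbove j)) (M.δ 1 x) h0
  have e2 : F ((borel S.base).δ 2 (borelMk S.base (Δ := op ⦋2⦌) h x)) = f (M.δ 2 x) :=
    hF (fun j => h ((2 : Fin 3).succAbove j)) (M.δ 2 x) h0
  rw [Fin.sum_univ_three, e0, e1, e2, toFun_eq_edgeValue hs, Phi_eq_edgeValue hs]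
  simp [f]
  abel

end FibreAction
end EquivariantContextuality

open EquivariantContextuality
theorem mainTheorem2 {R A G : Type u} [CommSemiring R] [Nontrivial R]
    (zero_sum_free : ∀ a b : R, a + b = 0 → a = 0 ∧ b = 0)
    [AddCommGroup A] [Finite A] [Group G]
    {M : SSet.{u}} [IsPartialGroup M] (β : NormalizedCocycle M A) (S : FibreAction β G)
    (hβ : S.betaGClass ≠ 0)
    (p : SDist R S.total (Action.trivial G (nerveSSet A))) (hp : IsRelative S.inclHom p) :
    IsEquivariantlyContextual p := by
  rintro ⟨d, rfl⟩
  obtain ⟨s, hs⟩ := exists_retraction_of_isRelative_comparison zero_sum_free S.inclHom d hp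
  -- Only the edges of `NA` are needed from the retraction property; an element `a` of `A` is such
  -- an edge, seen as a constant function on `Fin 1`.
  exact hβ (FibreAction.betaGClass_eq_zero fun a =>
    congrFun (hs (Δ := op ⦋1⦌) (fun _ => a : Fin 1 → A)) 0)
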